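/- Theorem 3.4. Let $K$ be a commutative ring with unit. All rings below are associative unital $K$-algebras, and ring homomorphisms are (unital) $K$-algebra homomorphisms. Let $i:A\to B$ be such a homomorphism, and regard $B$ as an $(A,A)$-bimodule through $i$. Assume that $A$ is a separable $K$-algebra, i.e. that $A$ is projective as a $K$-symmetric $(A,A)$-bimodule (equivalently, as a left module over $A\otimes_K A^{\mathrm{op}}$). Then the following are equivalent: (i) $i$ is a pure morphism of left $A$-modules, i.e. $L\otimes_A i: L\otimes_A A\to L\otimes_A B$ is injective for every right $A$-module $L$; (ii) $i$ is a pure morphism of right $A$-modules, i.e. $i\otimes_A L: A\otimes_A L\to B\otimes_A L$ is injective for every left $A$-module $L$; (iii) the map $i^+:B^+\to A^+$, $\varphi\mapsto\varphi\circ i$, is a split epimorphism of $(A,A)$-bimodules, where for an $(A,A)$-bimodule $M$ the character bimodule is $M^+=\mathrm{Hom}_{\mathbb Z}(M,\mathbb Q/\mathbb Z)$ with $(afa')(m)=f(a'ma)$; (iv) the functor $-\otimes_A B:\mathrm{Mod}_A\to\mathrm{Mod}_B$ from right $A$-modules to right $B$-modules is comonadic; (v) the functor $B\otimes_A-:{}_A\mathrm{Mod}\to{}_B\mathrm{Mod}$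 from left $A$-modules to left $B$-modules is comonadic. Here a functor is comonadic if it has a right adjoint and the comparison functor to the category of coalgebras over the induced comonad is an equivalence of categories. -/

import Mathlib

open CategoryTheory MulOpposite
open scoped TensorProduct

universe u w

namespace NCDescent

noncomputable section

/-! ### Separable algebras

Right `A`-modules are modules over `Aᵐᵒᵖ`, with `op a • m` standing for `m a`. -/

/-- The `K`-algebra `A` is separable: `A` is projective as a `K`-symmetric `(A, A)`-bimodule, that
is, as a module over the enveloping algebra `A ⊗[K] Aᵐᵒᵖ`, where `(a ⊗ op a') • x = a x a'`. -/
def IsSeparableAlgebra (K : Type w) (A : Type u) [CommRing K] [Ring A] [Algebra K A] : Prop :=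
  letI : Module (A ⊗[K] Aᵐᵒᵖ) A := TensorProduct.Algebra.module
  Module.Projective (A ⊗[K] Aᵐᵒᵖ) A

/-! ### The tensor product over a not necessarily commutative ring -/

section Tensor

variable (A : Type u) [Ring A]

/-- The subgroup of `M ⊗[ℤ] N` generated by the elements `m a ⊗ n - m ⊗ a n`. -/
def balancedRelations (M N : Type u) [AddCommGroup M] [Module Aᵐᵒᵖ M] [AddCommGroup N]
    [Module A N] : AddSubgroup (M ⊗[ℤ] N) :=
  AddSubgroup.closure
    {t | ∃ (m : M) (a : A) (n : N), t = (op a • m) ⊗ₜ[ℤ] n - m ⊗ₜ[ℤ] (a • n)}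

/-- The tensor product `M ⊗_A N` of a right `A`-module `M` and a left `A`-module `N`. -/
def BalancedTensor (M N : Type u) [AddCommGroup M] [Module Aᵐᵒᵖ M] [AddCommGroup N]
    [Module A N] : Type u :=
  (M ⊗[ℤ] N) ⧸ balancedRelations A M N

namespace BalancedTensor

variable {M M' M'' N N' N'' : Type u}
  [AddCommGroup M] [Module Aᵐᵒᵖ M] [AddCommGroup M'] [Module Aᵐᵒᵖ M']
  [AddCommGroup M''] [Module Aᵐᵒᵖ M'']
  [AddCommGroup N] [Module A N] [AddCommGroup N'] [Module A N']
  [AddCommGroup N''] [Module A N'']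

instance : AddCommGroup (BalancedTensor A M N) :=
  inferInstanceAs (AddCommGroup ((M ⊗[ℤ] N) ⧸ balancedRelations A M N))

/-- The projection `M ⊗[ℤ] N → M ⊗_A N`. -/
def mk : M ⊗[ℤ] N →+ BalancedTensor A M N :=
  QuotientAddGroup.mk' (balancedRelations A M N)

/-- The element `m ⊗ n` of `M ⊗_A N`. -/
def tmul (m : M) (n : N) : BalancedTensor A M N := mk A (m ⊗ₜ[ℤ] n)

theorem smul_tmul (m : M) (a : A) (n : N) : tmul A (op a • m) n = tmul A m (a • n) := by
  rw [← sub_eq_zero, tmul, tmul, ← map_sub]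
  exact (QuotientAddGroup.eq_zero_iff _).2 (AddSubgroup.subset_closure ⟨m, a, n, rfl⟩)

variable {A} in
theorem hom_ext {P : Type*} [AddCommGroup P] {f g : BalancedTensor A M N →+ P}
    (h : ∀ m n, f (tmul A m n) = g (tmul A m n)) : f = g := by
  refine QuotientAddGroup.addMonoidHom_ext _ (AddMonoidHom.ext fun t => ?_)
  induction t using TensorProduct.induction_on with
  | zero => simp
  | tmul m n => exact h m n
  | add x y hx hy => rw [map_add, map_add, hx, hy]

variable {A}

/-- The additive map `f ⊗ g : M ⊗_A N → M' ⊗_A N'` induced by `A`-linear maps `f` and `g`. -/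
def map (f : M →ₗ[Aᵐᵒᵖ] M') (g : N →ₗ[A] N') :
    BalancedTensor A M N →+ BalancedTensor A M' N' :=
  QuotientAddGroup.map (balancedRelations A M N) (balancedRelations A M' N')
    (TensorProduct.map f.toAddMonoidHom.toIntLinearMap
      g.toAddMonoidHom.toIntLinearMap).toAddMonoidHom
    (by
      refine (AddSubgroup.closure_le _).2 ?_
      rintro _ ⟨m, a, n, rfl⟩
      refine AddSubgroup.subset_closure ⟨f m, a, g n, ?_⟩
      simp)

@[simp]
theorem map_tmul (f : M →ₗ[Aᵐᵒᵖ] M') (g : N →ₗ[A] N') (m : M) (n : N) :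
    map f g (tmul A m n) = tmul A (f m) (g n) := rfl

theorem map_id : map (LinearMap.id : M →ₗ[Aᵐᵒᵖ] M) (LinearMap.id : N →ₗ[A] N) =
    AddMonoidHom.id _ :=
  hom_ext fun _ _ => rfl

theorem map_comp (f : M →ₗ[Aᵐᵒᵖ] M') (f' : M' →ₗ[Aᵐᵒᵖ] M'') (g : N →ₗ[A] N')
    (g' : N' →ₗ[A] N'') : map (f' ∘ₗ f) (g' ∘ₗ g) = (map f' g').comp (map f g) :=
  hom_ext fun _ _ => rfl

theorem add_tmul (m m' : M) (n : N) : tmul A (m + m') n = tmul A m n + tmul A m' n := by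
  simp [tmul, TensorProduct.add_tmul]

theorem tmul_add (m : M) (n n' : N) : tmul A m (n + n') = tmul A m n + tmul A m n' := by
  simp [tmul, TensorProduct.tmul_add]

theorem zero_tmul (n : N) : tmul A (0 : M) n = 0 := by simp [tmul]

theorem tmul_zero (m : M) : tmul A m (0 : N) = 0 := by simp [tmul]

variable (A M N)

/-- If `S` acts on `M` commuting with the right `A`-action, then `S` acts on `M ⊗_A N` by
`s (m ⊗ n) = s m ⊗ n`. -/
abbrev leftModule (S : Type u) [Ring S] [Module S M] [SMulCommClass S Aᵐᵒᵖ M] :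
    Module S (BalancedTensor A M N) :=
  Module.compHom _
    ({ toFun := fun s => map (DistribSMul.toLinearMap Aᵐᵒᵖ M s) LinearMap.id
       map_one' := hom_ext fun m n => by simp; rfl
       map_mul' := fun s t => hom_ext fun m n => by simp [mul_smul]; rfl
       map_zero' := hom_ext fun m n => by simp [zero_tmul]; rfl
       map_add' := fun s t => hom_ext fun m n => by
        simp [add_smul, add_tmul]; rfl } : S →+* AddMonoid.End (BalancedTensor A M N))

/-- If `T` acts on `N` commuting with the left `A`-action, then `T` acts on `M ⊗_A N` by
`t (m ⊗ n) = m ⊗ t n`. (For `T = Bᵐᵒᵖ` this is a right `B`-module structure.) -/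
abbrev rightModule (T : Type u) [Ring T] [Module T N] [SMulCommClass T A N] :
    Module T (BalancedTensor A M N) :=
  Module.compHom _
    ({ toFun := fun t => map LinearMap.id (DistribSMul.toLinearMap A N t)
       map_one' := hom_ext fun m n => by simp; rfl
       map_mul' := fun s t => hom_ext fun m n => by simp [mul_smul]; rfl
       map_zero' := hom_ext fun m n => by simp [tmul_zero]; rfl
       map_add' := fun s t => hom_ext fun m n => by
        simp [add_smul, tmul_add]; rfl } : T →+* AddMonoid.End (BalancedTensor A M N))

end BalancedTensor

end Tensor

/-! ### Pure morphisms -/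

section Pure

variable {A : Type u} [Ring A]

/-- A morphism `f` of right `A`-modules is pure if `f ⊗_A L` is injective for every left
`A`-module `L`. -/
def IsPureRight {M N : Type u} [AddCommGroup M] [Module Aᵐᵒᵖ M] [AddCommGroup N]
    [Module Aᵐᵒᵖ N] (f : M →ₗ[Aᵐᵒᵖ] N) : Prop :=
  ∀ (L : Type u) [AddCommGroup L] [Module A L],
    Function.Injective (BalancedTensor.map f (LinearMap.id : L →ₗ[A] L))

/-- A morphism `f` of left `A`-modules is pure if `L ⊗_A f` is injective for every right
`A`-module `L`. -/
def IsPureLeft {M N : Type u} [AddCommGroup M] [Module A M] [AddCommGroup N]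
    [Module A N] (f : M →ₗ[A] N) : Prop :=
  ∀ (L : Type u) [AddCommGroup L] [Module Aᵐᵒᵖ L],
    Function.Injective (BalancedTensor.map (LinearMap.id : L →ₗ[Aᵐᵒᵖ] L) f)

end Pure

/-! ### Bimodules and character bimodules -/

section Bimodule

/-- Morphisms of `(A, A)`-bimodules. -/
structure BimoduleHom (A M N : Type u) [Ring A] [AddCommGroup M] [Module A M] [Module Aᵐᵒᵖ M]
    [AddCommGroup N] [Module A N] [Module Aᵐᵒᵖ N] extends M →+ N where
  map_smul_left : ∀ (a : A) (m : M), toFun (a • m) = a • toFun m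
  map_smul_right : ∀ (a : A) (m : M), toFun (op a • m) = op a • toFun m

/-- The character bimodule `M⁺ = Ab(M, ℚ/ℤ)`. -/
def CharacterBimodule (M : Type u) [AddCommGroup M] : Type u := CharacterModule M

variable {A M N : Type u} [Ring A]
  [AddCommGroup M] [Module A M] [Module Aᵐᵒᵖ M] [AddCommGroup N] [Module A N] [Module Aᵐᵒᵖ N]

namespace BimoduleHom

instance : FunLike (BimoduleHom A M N) M N where
  coe f := f.toFun
  coe_injective := by
    rintro ⟨f, _, _⟩ ⟨g, _, _⟩ h
    have : f = g := AddMonoidHom.ext (congrFun h)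
    subst this
    rfl

/-- A split epimorphism of bimodules: a bimodule morphism that has a section which is a morphism
of bimodules. -/
def IsSplitEpi (f : BimoduleHom A M N) : Prop :=
  ∃ s : BimoduleHom A N M, ∀ n : N, f (s n) = n

end BimoduleHom

namespace CharacterBimodule

instance : AddCommGroup (CharacterBimodule M) := inferInstanceAs (AddCommGroup (CharacterModule M))

instance : FunLike (CharacterBimodule M) M (AddCircle (1 : ℚ)) :=
  inferInstanceAs (FunLike (CharacterModule M) M (AddCircle (1 : ℚ)))

@[ext] theorem ext {f g : CharacterBimodule M} (h : ∀ m, f m = g m) : f = g :=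
  DFunLike.ext _ _ h

/-- The left action `(a f)(m) = f(m a)`. -/
instance : Module A (CharacterBimodule M) where
  smul a f := AddMonoidHom.comp (show M →+ AddCircle (1 : ℚ) from f)
    (DistribSMul.toAddMonoidHom M (op a))
  one_smul f := ext fun m => congrArg f (one_smul Aᵐᵒᵖ m)
  mul_smul a b f := ext fun m => congrArg f (mul_smul (op b) (op a) m)
  smul_zero _ := rfl
  smul_add _ _ _ := rfl
  add_smul a b f := ext fun m =>
    (congrArg f (add_smul (op a) (op b) m)).trans (AddMonoidHom.map_add f _ _)
  zero_smul f := ext fun m => (congrArg f (zero_smul Aᵐᵒᵖ m)).trans (AddMonoidHom.map_zero f)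

/-- The right action `(f a)(m) = f(a m)`. -/
instance : Module Aᵐᵒᵖ (CharacterBimodule M) where
  smul a f := AddMonoidHom.comp (show M →+ AddCircle (1 : ℚ) from f)
    (DistribSMul.toAddMonoidHom M (unop a))
  one_smul f := ext fun m => congrArg f (one_smul A m)
  mul_smul a b f := ext fun m => congrArg f (mul_smul (unop b) (unop a) m)
  smul_zero _ := rfl
  smul_add _ _ _ := rfl
  add_smul a b f := ext fun m =>
    (congrArg f (add_smul (unop a) (unop b) m)).trans (AddMonoidHom.map_add f _ _)
  zero_smul f := ext fun m => (congrArg f (zero_smul A m)).trans (AddMonoidHom.map_zero f)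

theorem smul_apply {A M : Type u} [Ring A] [AddCommGroup M] [Module Aᵐᵒᵖ M] (a : A)
    (f : CharacterBimodule M) (m : M) : (a • f) m = f (op a • m) := rfl

theorem op_smul_apply {A M : Type u} [Ring A] [AddCommGroup M] [Module A M] (a : A)
    (f : CharacterBimodule M) (m : M) : (op a • f) m = f (a • m) := rfl

/-- The morphism `f⁺ : N⁺ → M⁺`, `φ ↦ φ ∘ f`, of bimodules induced by `f : M → N`. -/
def map (f : BimoduleHom A M N) :
    BimoduleHom A (CharacterBimodule N) (CharacterBimodule M) where
  toFun φ := AddMonoidHom.comp (show N →+ AddCircle (1 : ℚ) from φ) f.toAddMonoidHom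
  map_zero' := rfl
  map_add' _ _ := rfl
  map_smul_left a φ := ext fun m => congrArg φ (f.map_smul_right a m).symm
  map_smul_right a φ := ext fun m => congrArg φ (f.map_smul_left a m).symm

theorem map_apply (f : BimoduleHom A M N) (φ : CharacterBimodule N) (m : M) :
    map f φ m = φ (f m) := rfl

end CharacterBimodule

end Bimodule

/-! ### Extension of scalars along a ring homomorphism -/

section Extension

variable {A B : Type u} [Ring A] [Ring B]

/-- The ring `B`, regarded as a module over `A` (on both sides) through `i : A → B`, and over
itself. -/
@[nolint unusedArguments]
def Along (_i : A →+* B) : Type u := B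

namespace Along

variable (i : A →+* B)

instance : AddCommGroup (Along i) := inferInstanceAs (AddCommGroup B)

/-- `B` as a left `B`-module. -/
instance instLeft : Module B (Along i) := inferInstanceAs (Module B B)

/-- `B` as a right `B`-module. -/
instance instRight : Module Bᵐᵒᵖ (Along i) := inferInstanceAs (Module Bᵐᵒᵖ B)

/-- `B` as a left `A`-module: `a b = i(a) b`. -/
instance instLeftRestrict : Module A (Along i) := Module.compHom B i

/-- `B` as a right `A`-module: `b a = b i(a)`. -/
instance instRightRestrict : Module Aᵐᵒᵖ (Along i) := Module.compHom B i.op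

instance : SMulCommClass B Aᵐᵒᵖ (Along i) where
  smul_comm b a x := (mul_assoc b (x : B) (i (unop a))).symm

instance : SMulCommClass Bᵐᵒᵖ A (Along i) where
  smul_comm b a x := mul_assoc (i a) (x : B) (unop b)

/-- `i : A → B` as a morphism of left `A`-modules. -/
def homLeft : A →ₗ[A] Along i where
  toFun := i
  map_add' := i.map_add
  map_smul' := i.map_mul

/-- `i : A → B` as a morphism of right `A`-modules. -/
def homRight : A →ₗ[Aᵐᵒᵖ] Along i where
  toFun := i
  map_add' := i.map_add
  map_smul' a x := i.map_mul x (unop a)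

/-- `i : A → B` as a morphism of `(A, A)`-bimodules. -/
def homBimodule : BimoduleHom A A (Along i) where
  toFun := i
  map_zero' := i.map_zero
  map_add' := i.map_add
  map_smul_left := i.map_mul
  map_smul_right a x := i.map_mul x a

end Along

variable (i : A →+* B)

/-- The left `B`-module structure `b (b' ⊗ x) = b b' ⊗ x` on `B ⊗_A X`. -/
instance moduleAlongTensor (X : Type u) [AddCommGroup X] [Module A X] :
    Module B (BalancedTensor A (Along i) X) :=
  BalancedTensor.leftModule A (Along i) X B

/-- The right `B`-module structure `(x ⊗ b') b = x ⊗ b' b` on `X ⊗_A B`. -/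
instance moduleTensorAlong (X : Type u) [AddCommGroup X] [Module Aᵐᵒᵖ X] :
    Module Bᵐᵒᵖ (BalancedTensor A X (Along i)) :=
  BalancedTensor.rightModule A X (Along i) Bᵐᵒᵖ

theorem smul_along_tmul {X : Type u} [AddCommGroup X] [Module A X] (b : B) (b' : Along i) (x : X) :
    b • BalancedTensor.tmul A b' x = BalancedTensor.tmul A (b • b') x := rfl

theorem op_smul_tmul_along {X : Type u} [AddCommGroup X] [Module Aᵐᵒᵖ X] (b : B) (x : X)
    (b' : Along i) :
    op b • BalancedTensor.tmul A x b' = BalancedTensor.tmul A x (op b • b') := rfl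

/-- The functor `B ⊗_A - : _A Mod ⥤ _B Mod`. -/
def extendLeft : ModuleCat.{u} A ⥤ ModuleCat.{u} B where
  obj X := ModuleCat.of B (BalancedTensor A (Along i) X)
  map {X Y} f := ModuleCat.ofHom
    { toFun := BalancedTensor.map LinearMap.id f.hom
      map_add' := map_add _
      map_smul' := fun b t => DFunLike.congr_fun
        (BalancedTensor.hom_ext (fun _ _ => rfl) :
          (BalancedTensor.map LinearMap.id f.hom).comp
              (DistribSMul.toAddMonoidHom (BalancedTensor A (Along i) X) b) =
            (DistribSMul.toAddMonoidHom (BalancedTensor A (Along i) Y) b).comp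
              (BalancedTensor.map LinearMap.id f.hom)) t }
  map_id X := ModuleCat.hom_ext (LinearMap.ext fun t =>
    DFunLike.congr_fun (BalancedTensor.map_id (A := A) (M := Along i) (N := X)) t)
  map_comp f g := ModuleCat.hom_ext (LinearMap.ext fun t =>
    DFunLike.congr_fun
      (BalancedTensor.map_comp (LinearMap.id : Along i →ₗ[Aᵐᵒᵖ] Along i) LinearMap.id
        f.hom g.hom) t)

/-- The functor `- ⊗_A B : Mod_A ⥤ Mod_B`. -/
def extendRight : ModuleCat.{u} Aᵐᵒᵖ ⥤ ModuleCat.{u} Bᵐᵒᵖ where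
  obj X := ModuleCat.of Bᵐᵒᵖ (BalancedTensor A X (Along i))
  map {X Y} f := ModuleCat.ofHom
    { toFun := BalancedTensor.map f.hom LinearMap.id
      map_add' := map_add _
      map_smul' := fun b t => DFunLike.congr_fun
        (BalancedTensor.hom_ext (fun _ _ => rfl) :
          (BalancedTensor.map f.hom LinearMap.id).comp
              (DistribSMul.toAddMonoidHom (BalancedTensor A X (Along i)) b) =
            (DistribSMul.toAddMonoidHom (BalancedTensor A Y (Along i)) b).comp
              (BalancedTensor.map f.hom LinearMap.id)) t }
  map_id X := ModuleCat.hom_ext (LinearMap.ext fun t =>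
    DFunLike.congr_fun (BalancedTensor.map_id (A := A) (M := X) (N := Along i)) t)
  map_comp f g := ModuleCat.hom_ext (LinearMap.ext fun t =>
    DFunLike.congr_fun
      (BalancedTensor.map_comp f.hom g.hom (LinearMap.id : Along i →ₗ[A] Along i)
        LinearMap.id) t)

end Extension

/-- A functor is comonadic if it has a right adjoint such that the comparison functor to the
category of coalgebras over the induced comonad is an equivalence. -/
def IsComonadic {C D : Type*} [Category C] [Category D] (F : C ⥤ D) : Prop :=
  Nonempty (ComonadicLeftAdjoint F)

end

end NCDescent

/-! Everything is dualised into `ℚ/ℤ`, an injective cogenerator of abelian groups. Both extension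
functors are treated at once as a left adjoint `F` of restriction along `j : R → S`, with unit `η`;
a character of `F X` is then an `R`-balanced pairing of `S` and `X`, so that `(F X)⁺ = Hom_R(S,
X⁺)`.

Purity says that every `η` is injective. Injectivity at `X = R⁺` lets evaluation at `1` extend to a
character of `F(R⁺)`, which amounts to a section of `S⁺ → R⁺` linear on one side
(`exists_linear_section`). Averaging it over a separability idempotent makes it linear on both
sides. The two-sided condition is symmetric under passing to opposite rings, which is what joins the
left and right statements.

Conversely, a bilinear section splits `η⁺ : (F X)⁺ → X⁺` naturally and `R`-linearly. So `F` is
faithful, and for an `F`-cosplit pair `f, g : X → Y` the dual pair `Y⁺ ⇉ X⁺` is contractible. With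
`E` the equalizer, `E⁺` is thus a split, hence absolute, coequalizer, preserved by `Hom_R(S, -)`.
Dualising back, `F` preserves the equalizer, and Beck's theorem gives comonadicity. Finally, a
comonadic functor is faithful, and a left adjoint is faithful exactly when its unit is a
monomorphism; this returns to purity. -/

namespace NCDescent

noncomputable section

/-! ### Extension of scalars as a left adjoint of restriction of scalars -/

section Adjoint

variable {R S : Type u} [Ring R] [Ring S] {j : R →+* S}
  {F : ModuleCat.{u} R ⥤ ModuleCat.{u} S} (adj : F ⊣ ModuleCat.restrictScalars.{u} j)

/-- The unit `X → F X` of an adjunction `F ⊣ restrictScalars j`, as an additive map. -/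
def unitHom (X : ModuleCat.{u} R) : X →+ F.obj X :=
  (adj.unit.app X).hom.toAddMonoidHom

theorem unitHom_smul (X : ModuleCat.{u} R) (r : R) (x : X) :
    unitHom adj X (r • x) = j r • unitHom adj X x :=
  (adj.unit.app X).hom.map_smul r x

theorem map_unitHom {X Y : ModuleCat.{u} R} (f : X ⟶ Y) (x : X) :
    (F.map f).hom (unitHom adj X x) = unitHom adj Y (f.hom x) :=
  (LinearMap.congr_fun (congrArg ModuleCat.Hom.hom (adj.unit_naturality f)) x :)

theorem hom_ext_unitHom {X : ModuleCat.{u} R} {Z : ModuleCat.{u} S} {f g : F.obj X ⟶ Z}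
    (h : ∀ x, f.hom (unitHom adj X x) = g.hom (unitHom adj X x)) : f = g := by
  apply (adj.homEquiv X Z).injective
  ext x
  rw [adj.homEquiv_unit, adj.homEquiv_unit]
  exact h x

/-- The `S`-linear map `F X → Z` extending a `j`-semilinear map `X → Z`. -/
theorem exists_hom_unitHom {X : ModuleCat.{u} R} {Z : ModuleCat.{u} S} (β : X →+ Z)
    (hβ : ∀ (r : R) x, β (r • x) = j r • β x) :
    ∃ f : F.obj X ⟶ Z, ∀ x, f.hom (unitHom adj X x) = β x := by
  let g : X ⟶ (ModuleCat.restrictScalars j).obj Z :=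
    ModuleCat.ofHom (Y := (ModuleCat.restrictScalars j).obj Z)
      { toFun := β, map_add' := β.map_add, map_smul' := hβ }
  refine ⟨(adj.homEquiv X Z).symm g, fun x => ?_⟩
  have := (adj.homEquiv X Z).apply_symm_apply g
  rw [adj.homEquiv_unit] at this
  exact (LinearMap.congr_fun (congrArg ModuleCat.Hom.hom this) x :)

/-- The quotient map by the span kills `η(X)`, so it is zero by the uniqueness half of the universal
property. No explicit tensor product is needed. -/
theorem span_range_unitHom (X : ModuleCat.{u} R) :
    Submodule.span S (Set.range (unitHom adj X)) = ⊤ := by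
  set N := Submodule.span S (Set.range (unitHom adj X)) with hN
  have : ModuleCat.ofHom N.mkQ = (0 : F.obj X ⟶ ModuleCat.of S (F.obj X ⧸ N)) :=
    hom_ext_unitHom adj fun x =>
      (Submodule.Quotient.mk_eq_zero N).2 (Submodule.subset_span ⟨x, rfl⟩)
  rw [← N.ker_mkQ, LinearMap.ker_eq_top]
  exact congrArg ModuleCat.Hom.hom this

theorem addHom_ext_unitHom {X : ModuleCat.{u} R} {P : Type*} [AddCommGroup P]
    {φ ψ : F.obj X →+ P} (h : ∀ (b : S) x, φ (b • unitHom adj X x) = ψ (b • unitHom adj X x)) :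
    φ = ψ := by
  ext t
  have ht : t ∈ Submodule.span S (Set.range (unitHom adj X)) := by
    rw [span_range_unitHom]; trivial
  induction ht using Submodule.closure_induction with
  | zero => simp
  | add x y _ _ hx hy => rw [map_add, map_add, hx, hy]
  | smul_mem b t ht =>
    obtain ⟨x, rfl⟩ := ht
    exact h b x

/-- Characters of `F X` are the `R`-balanced pairings of `S` and `X`. -/
theorem exists_character_unitHom {X : ModuleCat.{u} R} (β : X →+ S →+ AddCircle (1 : ℚ))
    (hβ : ∀ (r : R) x b, β (r • x) b = β x (b * j r)) :
    ∃ φ : F.obj X →+ AddCircle (1 : ℚ), ∀ (b : S) x, φ (b • unitHom adj X x) = β x b := by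
  -- The pairing is an `R`-linear map from `X` to the coinduced module `S⁺`. It extends to an
  -- `S`-linear map on `F X`, and evaluation at `1` recovers the character.
  obtain ⟨g, hg⟩ := exists_hom_unitHom adj (Z := ModuleCat.of S (CharacterBimodule S))
    (X := X) { toFun := fun x => β x, map_zero' := map_zero β, map_add' := map_add β }
    (fun r x => CharacterBimodule.ext (hβ r x))
  refine ⟨{ toFun := fun t => (show CharacterBimodule S from g.hom t) (1 : S),
            map_zero' := ?_, map_add' := ?_ }, fun b x => ?_⟩
  · rw [map_zero]; rfl
  · intro s t; rw [map_add]; rfl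
  · change (show CharacterBimodule S from g.hom (b • unitHom adj X x)) (1 : S) = _
    rw [map_smul, hg]
    change β x (1 * b) = _
    rw [one_mul]

/-! ### Bilinear splittings of characters -/

/-- A section of the restriction `S⁺ → R⁺` along `j : R → S` which is linear over `R` on both
sides, in terms of the multiplications of `R` and `S`. -/
structure CharacterSplitting (j : R →+* S) where
  /-- The underlying additive map `R⁺ → S⁺`. -/
  toFun : (R →+ AddCircle (1 : ℚ)) →+ S →+ AddCircle (1 : ℚ)
  restrict : ∀ f r, toFun f (j r) = f r
  mul_right : ∀ f r b, toFun (f.comp (AddMonoidHom.mulRight r)) b = toFun f (b * j r)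
  mul_left : ∀ f r b, toFun (f.comp (AddMonoidHom.mulLeft r)) b = toFun f (j r * b)

/-- The action `(χ r)(x) = χ (r x)` of `R` on the characters of an `R`-module. -/
def smulCharacter {X : Type*} [AddCommGroup X] [Module R X] (χ : X →+ AddCircle (1 : ℚ)) (r : R) :
    X →+ AddCircle (1 : ℚ) :=
  χ.comp (DistribSMul.toAddMonoidHom X r)

@[simp]
theorem smulCharacter_apply {X : Type*} [AddCommGroup X] [Module R X]
    (χ : X →+ AddCircle (1 : ℚ)) (r : R) (x : X) : smulCharacter χ r x = χ (r • x) := rfl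

/-- A point of `X` outside a subgroup is separated from it by a character. -/
theorem exists_character_of_notMem {X : Type*} [AddCommGroup X] (N : AddSubgroup X) {x : X}
    (hx : x ∉ N) : ∃ χ : X →+ AddCircle (1 : ℚ), (∀ y ∈ N, χ y = 0) ∧ χ x ≠ 0 := by
  have h0 : (QuotientAddGroup.mk x : X ⧸ N) ≠ 0 := fun h =>
    hx ((QuotientAddGroup.eq_zero_iff x).1 h)
  obtain ⟨c, hc⟩ := CharacterModule.exists_character_apply_ne_zero_of_ne_zero h0
  refine ⟨AddMonoidHom.comp (show (X ⧸ N) →+ AddCircle (1 : ℚ) from c) (QuotientAddGroup.mk' N),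
    fun y hy => ?_, hc⟩
  have : QuotientAddGroup.mk' N y = 0 := (QuotientAddGroup.eq_zero_iff y).2 hy
  rw [AddMonoidHom.comp_apply, this, map_zero]

/-- This is the injectivity of `ℚ/ℤ`. -/
theorem exists_character_extend {X Y : Type*} [AddCommGroup X] [AddCommGroup Y] (u : X →+ Y)
    (hu : Function.Injective u) (χ : X →+ AddCircle (1 : ℚ)) :
    ∃ ω : Y →+ AddCircle (1 : ℚ), ∀ x, ω (u x) = χ x := by
  obtain ⟨ω, hω⟩ := CharacterModule.dual_surjective_of_injective u.toIntLinearMap hu χ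
  exact ⟨ω, fun x => DFunLike.congr_fun hω x⟩

/-- A character vanishing on the kernel of `u : X → Y` extends along `u`. -/
theorem exists_character_of_ker {X Y : Type*} [AddCommGroup X] [AddCommGroup Y] (u : X →+ Y)
    (χ : X →+ AddCircle (1 : ℚ)) (h : ∀ x, u x = 0 → χ x = 0) :
    ∃ ω : Y →+ AddCircle (1 : ℚ), ∀ x, ω (u x) = χ x := by
  obtain ⟨ω, hω⟩ := exists_character_extend (QuotientAddGroup.kerLift u)
    (QuotientAddGroup.kerLift_injective u) (QuotientAddGroup.lift u.ker χ h)
  exact ⟨ω, fun x => hω (QuotientAddGroup.mk x)⟩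

namespace CharacterSplitting

variable (s : CharacterSplitting j)

/-- The extension of characters of `X` to characters of `F X` given by a splitting:
`b • η x ↦ s (r ↦ χ (r x)) b`. -/
theorem exists_extend (X : ModuleCat.{u} R) :
    ∃ σ : (X →+ AddCircle (1 : ℚ)) → F.obj X →+ AddCircle (1 : ℚ), ∀ χ (b : S) x,
      σ χ (b • unitHom adj X x) = s.toFun (χ.comp (AddMonoidHom.flip (smulAddHom R X) x)) b := by
  have (χ : X →+ AddCircle (1 : ℚ)) := exists_character_unitHom adj (X := X)
    { toFun := fun x => s.toFun (χ.comp (AddMonoidHom.flip (smulAddHom R X) x))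
      map_zero' := by
        rw [map_zero, AddMonoidHom.comp_zero, map_zero]
      map_add' := fun x y => by
        rw [map_add, AddMonoidHom.comp_add, map_add] } (fun r x b => by
        refine .trans ?_ (s.mul_right _ r b)
        refine congrArg (s.toFun · b) ?_
        ext r'
        simp [mul_smul])
  choose σ hσ using this
  exact ⟨σ, hσ⟩

/-- The extension of a character `χ` of `X` to `F X`. -/
def extend (X : ModuleCat.{u} R) : (X →+ AddCircle (1 : ℚ)) → F.obj X →+ AddCircle (1 : ℚ) :=
  (s.exists_extend adj X).choose

theorem extend_apply (X : ModuleCat.{u} R) (χ : X →+ AddCircle (1 : ℚ)) (b : S) (x : X) :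
    s.extend adj X χ (b • unitHom adj X x) =
      s.toFun (χ.comp (AddMonoidHom.flip (smulAddHom R X) x)) b :=
  (s.exists_extend adj X).choose_spec χ b x

theorem extend_unitHom (X : ModuleCat.{u} R) (χ : X →+ AddCircle (1 : ℚ)) (x : X) :
    s.extend adj X χ (unitHom adj X x) = χ x := by
  -- The unit of `S` is written `j 1` so that `restrict` applies.
  have := s.extend_apply adj X χ (j 1) x
  rw [s.restrict, map_one, one_smul] at this
  simpa using this

theorem extend_add (X : ModuleCat.{u} R) (χ ψ : X →+ AddCircle (1 : ℚ)) :
    s.extend adj X (χ + ψ) = s.extend adj X χ + s.extend adj X ψ :=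
  addHom_ext_unitHom adj fun b x => by
    rw [AddMonoidHom.add_apply, extend_apply, extend_apply, extend_apply, AddMonoidHom.add_comp,
      map_add, AddMonoidHom.add_apply]

/-- This is where the second linearity, `mul_left`, is needed; `mul_right` was spent on making the
pairing balanced. -/
theorem extend_smulCharacter (X : ModuleCat.{u} R) (χ : X →+ AddCircle (1 : ℚ)) (r : R) :
    s.extend adj X (smulCharacter χ r) = smulCharacter (s.extend adj X χ) (j r) :=
  addHom_ext_unitHom adj fun b x => by
    rw [smulCharacter_apply, smul_smul, extend_apply, extend_apply, ← s.mul_left]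
    refine congrArg (s.toFun · b) ?_
    ext r'
    simp [mul_smul]

theorem extend_comp {X Y : ModuleCat.{u} R} (f : X ⟶ Y) (χ : Y →+ AddCircle (1 : ℚ)) :
    s.extend adj X (χ.comp f.hom.toAddMonoidHom) =
      (s.extend adj Y χ).comp (F.map f).hom.toAddMonoidHom :=
  addHom_ext_unitHom adj fun b x => by
    rw [AddMonoidHom.comp_apply]
    refine .trans (extend_apply ..) ?_
    refine .trans ?_ (congrArg (s.extend adj Y χ)
      (((F.map f).hom.map_smul b _).trans (congrArg (b • ·) (map_unitHom adj f x)))).symm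
    rw [extend_apply]
    refine congrArg (s.toFun · b) ?_
    ext r'
    simp

end CharacterSplitting

end Adjoint

/-! ### Equalizers of modules -/

section Equalizer

open Limits

variable {R : Type u} [Ring R]

theorem nonempty_isLimit_fork {E X Y : ModuleCat.{u} R} {f g : X ⟶ Y} {ι : E ⟶ X}
    (w : ι ≫ f = ι ≫ g) (hι : Function.Injective ι.hom)
    (h : ∀ x, f.hom x = g.hom x → ∃ e, ι.hom e = x) : Nonempty (IsLimit (Fork.ofι ι w)) := by
  refine ⟨Fork.IsLimit.mk' _ fun t => ?_⟩
  have ht (z : t.pt) : t.ι.hom z ∈ LinearMap.range ι.hom :=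
    h _ (LinearMap.congr_fun (congrArg ModuleCat.Hom.hom t.condition) z :)
  refine ⟨ModuleCat.ofHom ((LinearEquiv.ofInjective ι.hom hι).symm.toLinearMap ∘ₗ
    t.ι.hom.codRestrict _ ht), ?_, fun {m} hm => ?_⟩
  · ext z
    exact congrArg Subtype.val
      ((LinearEquiv.ofInjective ι.hom hι).apply_symm_apply (t.ι.hom.codRestrict _ ht z))
  · ext z
    apply hι
    refine (LinearMap.congr_fun (congrArg ModuleCat.Hom.hom hm) z).trans ?_
    exact (congrArg Subtype.val
      ((LinearEquiv.ofInjective ι.hom hι).apply_symm_apply (t.ι.hom.codRestrict _ ht z))).symm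

/-- `F` preserves the equalizer of `f` and `g` as soon as it does so on the level of elements. -/
theorem preservesLimit_parallelPair {S : Type u} [Ring S] {F : ModuleCat.{u} R ⥤ ModuleCat.{u} S}
    {X Y : ModuleCat.{u} R} {f g : X ⟶ Y}
    (h : ∀ (E : ModuleCat.{u} R) (ι : E ⟶ X), ι ≫ f = ι ≫ g → Function.Injective ι.hom →
      (∀ x, f.hom x = g.hom x → ∃ e, ι.hom e = x) → Function.Injective (F.map ι).hom ∧
        ∀ x, (F.map f).hom x = (F.map g).hom x → ∃ e, (F.map ι).hom e = x) :
    PreservesLimit (parallelPair f g) F := by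
  let N := LinearMap.eqLocus f.hom g.hom
  let ι : ModuleCat.of R N ⟶ X := ModuleCat.ofHom N.subtype
  have w : ι ≫ f = ι ≫ g := by
    ext x
    exact x.2
  have hι : Function.Injective ι.hom := N.injective_subtype
  have hx : ∀ x, f.hom x = g.hom x → ∃ e, ι.hom e = x := fun x hx => ⟨⟨x, hx⟩, rfl⟩
  obtain ⟨h₁, h₂⟩ := h _ ι w hι hx
  refine preservesLimit_of_preserves_limit_cone (nonempty_isLimit_fork w hι hx).some
    ((isLimitMapConeForkEquiv F w).symm (nonempty_isLimit_fork
      (by rw [← F.map_comp, w, F.map_comp]) h₁ h₂).some)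

end Equalizer

/-! ### Comonadicity from a splitting of characters -/

section Comonadic

variable {R S : Type u} [Ring R] [Ring S] {j : R →+* S}
  {F : ModuleCat.{u} R ⥤ ModuleCat.{u} S}

/-- For an `F`-cosplit pair `f, g : X → Y`, the pair `f⁺, g⁺ : Y⁺ → X⁺` is contractible. -/
theorem CharacterSplitting.exists_contraction (adj : F ⊣ ModuleCat.restrictScalars.{u} j)
    (s : CharacterSplitting j) {X Y : ModuleCat.{u} R}
    (f g : X ⟶ Y) [h : F.IsCosplitPair f g] :
    ∃ T : (X →+ AddCircle (1 : ℚ)) →+ Y →+ AddCircle (1 : ℚ),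
      (∀ χ (r : R), T (smulCharacter χ r) = smulCharacter (T χ) r) ∧
      (∀ χ x, T χ (g.hom x) = χ x) ∧
      ∀ (ω : Y →+ AddCircle (1 : ℚ)) (x : X), T (ω.comp f.hom.toAddMonoidHom) (f.hom x) =
        T (ω.comp g.hom.toAddMonoidHom) (f.hom x) := by
  obtain ⟨W, k, ⟨q⟩⟩ := h.splittable
  let t := q.rightRetraction.hom
  -- The cosplitting provides `t : F Y → F X` with `t ∘ F g = id` and `t ∘ F f` factoring through
  -- the equalizer `k` of `F f` and `F g`. The contraction is `T χ = (extend χ) ∘ t ∘ η`. The last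
  -- identity holds because `F f` and `F g` agree after `k`.
  refine ⟨
    { toFun := fun χ => ((s.extend adj X χ).comp t.toAddMonoidHom).comp (unitHom adj Y)
      map_zero' := ?_
      map_add' := fun χ ψ => by
        rw [s.extend_add, AddMonoidHom.add_comp, AddMonoidHom.add_comp] },
    fun χ r => ?_, fun χ x => ?_, fun ω x => ?_⟩
  · have := s.extend_add adj X 0 0
    rw [add_zero, left_eq_add] at this
    rw [this, AddMonoidHom.zero_comp, AddMonoidHom.zero_comp]
  · ext y
    change s.extend adj X (smulCharacter χ r) (t (unitHom adj Y y)) =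
      s.extend adj X χ (t (unitHom adj Y (r • y)))
    rw [s.extend_smulCharacter, smulCharacter_apply, unitHom_smul, map_smul t]
  · change s.extend adj X χ (t (unitHom adj Y (g.hom x))) = χ x
    have h₁ : t ((F.map g).hom (unitHom adj X x)) = unitHom adj X x :=
      LinearMap.congr_fun (congrArg ModuleCat.Hom.hom q.bottom_rightRetraction) _
    rw [← map_unitHom, h₁, s.extend_unitHom]
  · change s.extend adj X (ω.comp f.hom.toAddMonoidHom) (t (unitHom adj Y (f.hom x))) =
      s.extend adj X (ω.comp g.hom.toAddMonoidHom) (t (unitHom adj Y (f.hom x)))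
    have h₁ : t ((F.map f).hom (unitHom adj X x)) =
        k.hom (q.leftRetraction.hom (unitHom adj X x)) :=
      LinearMap.congr_fun (congrArg ModuleCat.Hom.hom q.top_rightRetraction) _
    rw [← map_unitHom, h₁, s.extend_comp, s.extend_comp]
    exact congrArg (s.extend adj Y ω)
      (LinearMap.congr_fun (congrArg ModuleCat.Hom.hom q.condition) _ :)

/-- The character `x ↦ φ (b • η x)` of `X` obtained from a character of `F X`. -/
def pullbackCharacter (adj : F ⊣ ModuleCat.restrictScalars.{u} j)
    {X : ModuleCat.{u} R} (φ : F.obj X →+ AddCircle (1 : ℚ)) :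
    S →+ X →+ AddCircle (1 : ℚ) where
  toFun b := (smulCharacter φ b).comp (unitHom adj X)
  map_zero' := by
    ext x
    simp
  map_add' b c := by
    ext x
    simp [add_smul]

theorem pullbackCharacter_apply (adj : F ⊣ ModuleCat.restrictScalars.{u} j)
    {X : ModuleCat.{u} R} (φ : F.obj X →+ AddCircle (1 : ℚ))
    (b : S) (x : X) : pullbackCharacter adj φ b x = φ (b • unitHom adj X x) := rfl

theorem pullbackCharacter_mul (adj : F ⊣ ModuleCat.restrictScalars.{u} j)
    {X : ModuleCat.{u} R} (φ : F.obj X →+ AddCircle (1 : ℚ))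
    (b : S) (r : R) :
    pullbackCharacter adj φ (b * j r) = smulCharacter (pullbackCharacter adj φ b) r := by
  ext x
  rw [smulCharacter_apply, pullbackCharacter_apply, pullbackCharacter_apply, unitHom_smul, mul_smul]

theorem map_smul_unitHom (adj : F ⊣ ModuleCat.restrictScalars.{u} j)
    {X Y : ModuleCat.{u} R} (f : X ⟶ Y) (b : S) (x : X) :
    (F.map f).hom (b • unitHom adj X x) = b • unitHom adj Y (f.hom x) := by
  rw [map_smul, map_unitHom]

/-! ### Preservation of an equalizer with contractible dual -/

section

variable {E X Y : ModuleCat.{u} R} {f g : X ⟶ Y} {ι : E ⟶ X}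
  {T : (X →+ AddCircle (1 : ℚ)) →+ Y →+ AddCircle (1 : ℚ)}

/-- The difference `χ - ψ` vanishes on the kernel of `f - g`, so it has the form `ω ∘ f - ω ∘ g`,
which is killed by `T(-) ∘ f`. Hence `χ ↦ T χ ∘ f` depends only on the restriction of `χ` to `E`. -/
theorem contraction_congr (hE : ∀ x, f.hom x = g.hom x → ∃ e, ι.hom e = x)
    (hfg : ∀ (ω : Y →+ AddCircle (1 : ℚ)) (x : X), T (ω.comp f.hom.toAddMonoidHom) (f.hom x) =
        T (ω.comp g.hom.toAddMonoidHom) (f.hom x))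
    {χ ψ : X →+ AddCircle (1 : ℚ)} (h : ∀ e, χ (ι.hom e) = ψ (ι.hom e)) (x : X) :
    T χ (f.hom x) = T ψ (f.hom x) := by
  obtain ⟨ω, hω⟩ := exists_character_of_ker (f.hom - g.hom).toAddMonoidHom (χ - ψ) fun x hx => by
    obtain ⟨e, rfl⟩ := hE x (sub_eq_zero.1 hx)
    exact sub_eq_zero.2 (h e)
  have : χ - ψ = ω.comp f.hom.toAddMonoidHom - ω.comp g.hom.toAddMonoidHom := by
    ext x
    rw [← hω x, AddMonoidHom.sub_apply]
    exact map_sub ω _ _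
  rw [← sub_eq_zero, ← AddMonoidHom.sub_apply, ← map_sub, this, map_sub, AddMonoidHom.sub_apply,
    hfg, sub_self]

/-- Extending a character of `E` to `X` and then applying `T(-) ∘ f` is an `R`-linear section of
`ι⁺`. Applied to the pairing of a character of `F E`, it extends that character along `F ι`, so no
nonzero element can die in `F X`. -/
theorem map_injective_of_contraction (adj : F ⊣ ModuleCat.restrictScalars.{u} j)
    (w : ι ≫ f = ι ≫ g) (hι : Function.Injective ι.hom)
    (hE : ∀ x, f.hom x = g.hom x → ∃ e, ι.hom e = x)
    (hT : ∀ χ (r : R), T (smulCharacter χ r) = smulCharacter (T χ) r)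
    (hg : ∀ χ x, T χ (g.hom x) = χ x)
    (hfg : ∀ (ω : Y →+ AddCircle (1 : ℚ)) (x : X), T (ω.comp f.hom.toAddMonoidHom) (f.hom x) =
        T (ω.comp g.hom.toAddMonoidHom) (f.hom x)) :
    Function.Injective (F.map ι).hom := by
  refine (injective_iff_map_eq_zero _).2 fun z hz => by_contra fun hz0 => ?_
  obtain ⟨φ, -, hφ⟩ := exists_character_of_notMem (⊥ : AddSubgroup (F.obj E)) hz0
  -- The choice `ε` need be neither additive nor `R`-linear; `contraction_congr` makes `T (ε ψ) ∘ f`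
  -- both in `ψ`.
  choose ε hε using exists_character_extend ι.hom.toAddMonoidHom hι
  replace hε (ψ : E →+ AddCircle (1 : ℚ)) (e : E) : ε ψ (ι.hom e) = ψ e := hε ψ e
  let ψ := pullbackCharacter adj φ
  have hcongr {χ χ' : X →+ AddCircle (1 : ℚ)} (h : ∀ e, χ (ι.hom e) = χ' (ι.hom e)) (x : X) :=
    contraction_congr hE hfg h x
  obtain ⟨Φ, hΦ⟩ := exists_character_unitHom adj (X := X)
    { toFun := fun x =>
        { toFun := fun b => T (ε (ψ b)) (f.hom x)
          map_zero' := by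
            rw [hcongr (χ' := 0) fun e => by rw [hε, map_zero]; rfl, map_zero]
            rfl
          map_add' := fun b c => by
            rw [← AddMonoidHom.add_apply, ← map_add]
            exact hcongr (fun e => by
              rw [hε, AddMonoidHom.add_apply, hε, hε, map_add, AddMonoidHom.add_apply]) x }
      map_zero' := by
        ext b
        simp
      map_add' := fun x y => by
        ext b
        simp }
    (fun r x b => by
      change T (ε (ψ b)) (f.hom (r • x)) = T (ε (ψ (b * j r))) (f.hom x)
      rw [map_smul, ← smulCharacter_apply, ← hT]
      refine hcongr (fun e => ?_) x
      rw [hε, smulCharacter_apply, ← map_smul, hε, pullbackCharacter_mul, smulCharacter_apply])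
  have : Φ.comp (F.map ι).hom.toAddMonoidHom = φ := addHom_ext_unitHom adj fun b e => by
    have hw : f.hom (ι.hom e) = g.hom (ι.hom e) :=
      LinearMap.congr_fun (congrArg ModuleCat.Hom.hom w) e
    change Φ ((F.map ι).hom (b • unitHom adj E e)) = _
    rw [map_smul_unitHom, hΦ]
    change T (ε (ψ b)) (f.hom (ι.hom e)) = _
    rw [hw, hg, hε]
    rfl
  apply hφ
  rw [← this]
  exact (congrArg Φ hz).trans (map_zero Φ)

/-- If `φ` vanishes on the image of `F ι`, applying `T` to its pairing gives a character `Φ` of `F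
Y` with `φ = Φ ∘ F g - Φ ∘ F f`. So `φ` vanishes wherever `F f` and `F g` agree, and cannot separate
such a point from the image. -/
theorem map_exact_of_contraction (adj : F ⊣ ModuleCat.restrictScalars.{u} j)
    (hE : ∀ x, f.hom x = g.hom x → ∃ e, ι.hom e = x)
    (hT : ∀ χ (r : R), T (smulCharacter χ r) = smulCharacter (T χ) r)
    (hg : ∀ χ x, T χ (g.hom x) = χ x)
    (hfg : ∀ (ω : Y →+ AddCircle (1 : ℚ)) (x : X), T (ω.comp f.hom.toAddMonoidHom) (f.hom x) =
        T (ω.comp g.hom.toAddMonoidHom) (f.hom x))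
    (z : F.obj X) (hz : (F.map f).hom z = (F.map g).hom z) : ∃ e, (F.map ι).hom e = z := by
  by_contra hz0
  obtain ⟨φ, hφ, hφz⟩ := exists_character_of_notMem (F.map ι).hom.toAddMonoidHom.range (x := z) hz0
  let ψ := pullbackCharacter adj φ
  obtain ⟨Φ, hΦ⟩ := exists_character_unitHom adj (X := Y) (AddMonoidHom.flip (T.comp ψ))
    (fun r y b => by
      change T (ψ b) (r • y) = T (ψ (b * j r)) y
      rw [pullbackCharacter_mul, hT, smulCharacter_apply])
  have : Φ.comp (F.map g).hom.toAddMonoidHom - Φ.comp (F.map f).hom.toAddMonoidHom = φ :=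
    addHom_ext_unitHom adj fun b x => by
      change Φ ((F.map g).hom (b • unitHom adj X x)) - Φ ((F.map f).hom (b • unitHom adj X x)) = _
      rw [map_smul_unitHom, map_smul_unitHom, hΦ, hΦ]
      change T (ψ b) (g.hom x) - T (ψ b) (f.hom x) = _
      rw [hg, contraction_congr (χ := ψ b) (ψ := 0) hE hfg (fun e => ?_) x, map_zero]
      · exact sub_zero _
      · rw [pullbackCharacter_apply, ← map_smul_unitHom]
        exact hφ _ ⟨_, rfl⟩
  apply hφz
  rw [← this]
  exact sub_eq_zero.2 (congrArg Φ hz.symm)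

end

/-- Beck's theorem. Faithfulness holds because characters of `Y` extend along `η` and separate
points; it gives reflection of isomorphisms, as module categories are balanced. -/
theorem CharacterSplitting.isComonadic (adj : F ⊣ ModuleCat.restrictScalars.{u} j)
    (s : CharacterSplitting j) : IsComonadic F := by
  have : F.Faithful := ⟨fun {X Y f g} hfg => by
    ext x
    by_contra hne
    obtain ⟨χ, -, hχ⟩ := exists_character_of_notMem (⊥ : AddSubgroup Y)
      (x := f.hom x - g.hom x) (sub_ne_zero.2 hne)
    apply hχ
    rw [map_sub, ← s.extend_unitHom adj, ← s.extend_unitHom adj, ← map_unitHom, ← map_unitHom,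
      hfg, sub_self]⟩
  have : F.ReflectsIsomorphisms := inferInstance
  have : Comonad.HasEqualizerOfIsCosplitPair F := ⟨fun f g _ => inferInstance⟩
  have : Comonad.PreservesLimitOfIsCosplitPair F := ⟨fun f g _ => by
    obtain ⟨T, hT, hg, hfg⟩ := s.exists_contraction adj f g
    exact preservesLimit_parallelPair fun E ι w hι hE =>
      ⟨map_injective_of_contraction adj w hι hE hT hg hfg,
        map_exact_of_contraction adj hE hT hg hfg⟩⟩
  exact ⟨Comonad.comonadicOfHasPreservesFSplitEqualizersOfReflectsIsomorphisms adj⟩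

/-! ### From comonadicity to injective units -/

theorem IsComonadic.faithful {C D : Type*} [Category C] [Category D] {F : C ⥤ D}
    (h : IsComonadic F) : F.Faithful := by
  obtain ⟨⟨G, adj, _⟩⟩ := h
  -- `F` is the comparison equivalence followed by the faithful forgetful functor from coalgebras.
  exact inferInstanceAs (Comonad.comparison adj ⋙ adj.toComonad.forget).Faithful

theorem unitHom_injective_of_faithful (adj : F ⊣ ModuleCat.restrictScalars.{u} j)
    [F.Faithful] (X : ModuleCat.{u} R) :
    Function.Injective (unitHom adj X) :=
  (ModuleCat.mono_iff_injective _).1 (inferInstanceAs (Mono (adj.unit.app X)))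

end Comonadic

/-! ### Separability idempotents -/

section Separable

/-- `A ⊗[K] A` contains an element `e` with `μ(e) = 1` and `a e = e a` for all `a`. -/
def HasSeparabilityIdempotent (K : Type w) (A : Type u) [CommRing K] [Ring A] [Algebra K A] :
    Prop :=
  ∃ e : A ⊗[K] A, LinearMap.mul' K A e = 1 ∧
    ∀ a, (LinearMap.mulLeft K a).rTensor A e = (LinearMap.mulRight K a).lTensor A e

variable {K : Type w} {A : Type u} [CommRing K] [Ring A] [Algebra K A]

/-- Projectivity splits the surjection `t ↦ t • 1` by a bimodule map `σ`. The idempotent is `σ 1`,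
and `a e = e a` since both sides are `σ a`. -/
theorem IsSeparableAlgebra.hasSeparabilityIdempotent (h : IsSeparableAlgebra K A) :
    HasSeparabilityIdempotent K A := by
  let : Module (A ⊗[K] Aᵐᵒᵖ) A := TensorProduct.Algebra.module
  have hsmul (a : A) (b : Aᵐᵒᵖ) (m : A) : (a ⊗ₜ[K] b : A ⊗[K] Aᵐᵒᵖ) • m = a * (m * unop b) :=
    TensorProduct.Algebra.smul_def a b m
  have : Module.Projective (A ⊗[K] Aᵐᵒᵖ) A := h
  obtain ⟨σ, hσ⟩ := Module.projective_lifting_property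
    (LinearMap.toSpanSingleton (A ⊗[K] Aᵐᵒᵖ) A 1) LinearMap.id fun a =>
      ⟨a ⊗ₜ 1, by simp [hsmul]⟩
  let θ : A ⊗[K] Aᵐᵒᵖ →ₗ[K] A ⊗[K] A := (opLinearEquiv K).symm.toLinearMap.lTensor A
  have hμ (t : A ⊗[K] Aᵐᵒᵖ) : LinearMap.mul' K A (θ t) = t • (1 : A) := by
    induction t using TensorProduct.induction_on with
    | zero => rw [map_zero, map_zero]; exact (zero_smul (A ⊗[K] Aᵐᵒᵖ) (1 : A)).symm
    | tmul x y => simp [θ, hsmul]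
    | add x y hx hy => rw [map_add, map_add, hx, hy, add_smul]
  have hl (a : A) (t : A ⊗[K] Aᵐᵒᵖ) :
      (LinearMap.mulLeft K a).rTensor A (θ t) = θ ((a ⊗ₜ 1) * t) := by
    induction t using TensorProduct.induction_on with
    | zero => simp
    | tmul x y => simp [θ]
    | add x y hx hy => rw [map_add, map_add, hx, hy, mul_add, map_add]
  have hr (a : A) (t : A ⊗[K] Aᵐᵒᵖ) :
      (LinearMap.mulRight K a).lTensor A (θ t) = θ ((1 ⊗ₜ op a) * t) := by
    induction t using TensorProduct.induction_on with
    | zero => simp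
    | tmul x y => simp [θ]
    | add x y hx hy => rw [map_add, map_add, hx, hy, mul_add, map_add]
  refine ⟨θ (σ 1), ?_, fun a => ?_⟩
  · rw [hμ]
    exact LinearMap.congr_fun hσ 1
  · rw [hl, hr, ← smul_eq_mul, ← smul_eq_mul, ← map_smul, ← map_smul, hsmul, hsmul]
    simp

/-- Swapping the two tensor factors turns an idempotent for `A` into one for `Aᵐᵒᵖ`. -/
theorem HasSeparabilityIdempotent.op (h : HasSeparabilityIdempotent K A) :
    HasSeparabilityIdempotent K Aᵐᵒᵖ := by
  obtain ⟨e, he, hc⟩ := h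
  let θ : A ⊗[K] A →ₗ[K] Aᵐᵒᵖ ⊗[K] Aᵐᵒᵖ :=
    TensorProduct.map (opLinearEquiv K).toLinearMap (opLinearEquiv K).toLinearMap ∘ₗ
      (TensorProduct.comm K A A).toLinearMap
  have hμ (t : A ⊗[K] A) : LinearMap.mul' K Aᵐᵒᵖ (θ t) = MulOpposite.op (LinearMap.mul' K A t) := by
    induction t using TensorProduct.induction_on with
    | zero => simp
    | tmul x y => simp [θ]
    | add x y hx hy => rw [map_add, map_add, hx, hy, map_add, MulOpposite.op_add]
  have hl (a : Aᵐᵒᵖ) (t : A ⊗[K] A) : (LinearMap.mulLeft K a).rTensor Aᵐᵒᵖ (θ t) =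
      θ ((LinearMap.mulRight K (unop a)).lTensor A t) := by
    induction t using TensorProduct.induction_on with
    | zero => simp
    | tmul x y => simp [θ]
    | add x y hx hy => rw [map_add, map_add, hx, hy, map_add, map_add]
  have hr (a : Aᵐᵒᵖ) (t : A ⊗[K] A) : (LinearMap.mulRight K a).lTensor Aᵐᵒᵖ (θ t) =
      θ ((LinearMap.mulLeft K (unop a)).rTensor A t) := by
    induction t using TensorProduct.induction_on with
    | zero => simp
    | tmul x y => simp [θ]
    | add x y hx hy => rw [map_add, map_add, hx, hy, map_add, map_add]
  exact ⟨θ e, by rw [hμ, he, MulOpposite.op_one], fun a => by rw [hl, hr, hc]⟩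

end Separable

/-! ### Splittings of characters over separable algebras -/

section Splitting

variable {K : Type w} {R S : Type u} [CommRing K] [Ring R] [Ring S] [Algebra K R] {j : R →+* S}

/-- If the units `X → F X` are injective, the restriction of characters along `j` has a one-sided
linear section. -/
theorem exists_linear_section {F : ModuleCat.{u} R ⥤ ModuleCat.{u} S}
    (adj : F ⊣ ModuleCat.restrictScalars.{u} j)
    (h : ∀ X, Function.Injective (unitHom adj X)) :
    ∃ t : (R →+ AddCircle (1 : ℚ)) →+ S →+ AddCircle (1 : ℚ),
      (∀ f r, t f (j r) = f r) ∧
      ∀ f r b, t (f.comp (AddMonoidHom.mulRight r)) b = t f (b * j r) := by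
  let X := ModuleCat.of R (CharacterBimodule R)
  let ev : X →+ AddCircle (1 : ℚ) :=
    { toFun := fun f => (show CharacterBimodule R from f) (1 : R)
      map_zero' := rfl
      map_add' := fun _ _ => rfl }
  -- The section is `t f b = φ (b • η f)`. At `b = j r` it gives `φ (η (r • f)) = (r • f) 1 = f r`.
  obtain ⟨φ, hφ⟩ := exists_character_extend (unitHom adj X) (h X) ev
  let c : (R →+ AddCircle (1 : ℚ)) →+ X :=
    { toFun := fun f => f, map_zero' := rfl, map_add' := fun _ _ => rfl }
  have hc (f : R →+ AddCircle (1 : ℚ)) (r : R) :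
      c (f.comp (AddMonoidHom.mulRight r)) = r • c f := rfl
  refine ⟨AddMonoidHom.flip ((AddMonoidHom.flip (pullbackCharacter adj φ)).comp c).flip,
    fun f r => ?_, fun f r b => ?_⟩
  · change φ (j r • unitHom adj X (c f)) = f r
    rw [← unitHom_smul, hφ]
    exact congrArg f (one_mul r)
  · change φ (b • unitHom adj X (c (f.comp (AddMonoidHom.mulRight r)))) =
      φ ((b * j r) • unitHom adj X (c f))
    rw [hc, unitHom_smul, mul_smul]

/-- Averaging a one-sided linear section over a separability idempotent. -/
theorem HasSeparabilityIdempotent.nonempty_characterSplitting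
    (hR : HasSeparabilityIdempotent K R)
    (hj : ∀ (k : K) (b : S), j (algebraMap K R k) * b = b * j (algebraMap K R k))
    (t : (R →+ AddCircle (1 : ℚ)) →+ S →+ AddCircle (1 : ℚ))
    (ht : ∀ f r, t f (j r) = f r)
    (htr : ∀ f r b, t (f.comp (AddMonoidHom.mulRight r)) b = t f (b * j r)) :
    Nonempty (CharacterSplitting j) := by
  obtain ⟨e, he, hc⟩ := hR
  -- For `e = ∑ x ⊗ y` the averaged section is `s f b = ∑ t (f (x ·)) (j y * b)`.
  let β (f : R →+ AddCircle (1 : ℚ)) : R →+ R →+ S →+ AddCircle (1 : ℚ) :=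
    { toFun := fun x =>
        { toFun := fun y => (t (f.comp (AddMonoidHom.mulLeft x))).comp (AddMonoidHom.mulLeft (j y))
          map_zero' := by ext b; simp
          map_add' := fun y y' => by ext b; simp [add_mul] }
      map_zero' := by
        ext y b
        have : f.comp (AddMonoidHom.mulLeft 0) = 0 := by ext; simp
        simp [this]
      map_add' := fun x x' => by
        ext y b
        have : f.comp (AddMonoidHom.mulLeft (x + x')) =
          f.comp (AddMonoidHom.mulLeft x) + f.comp (AddMonoidHom.mulLeft x') := by
          ext; simp [add_mul]
        simp [this] }
  have hβ (f : R →+ AddCircle (1 : ℚ)) (x y : R) (b : S) :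
    β f x y b = t (f.comp (AddMonoidHom.mulLeft x)) (j y * b) := rfl
  let Γ (f : R →+ AddCircle (1 : ℚ)) : R ⊗[K] R →+ S →+ AddCircle (1 : ℚ) :=
    TensorProduct.liftAddHom (β f) fun k x y => by
      ext b
      -- Balancedness over `K`: the scalar moves to the right of the argument of `f`, crosses `t` by
      -- `htr`, and returns to `y` because its image in `S` is central.
      have : f.comp (AddMonoidHom.mulLeft (k • x)) =
          (f.comp (AddMonoidHom.mulLeft x)).comp (AddMonoidHom.mulRight (algebraMap K R k)) := by
        ext r
        simp [Algebra.smul_def, ← Algebra.commutes k, mul_assoc,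
          Algebra.left_comm]
      rw [hβ, hβ, this, htr, ← hj, Algebra.smul_def, map_mul j, mul_assoc]
  have hΓ (f : R →+ AddCircle (1 : ℚ)) (x y : R) (b : S) :
    Γ f (x ⊗ₜ y) b = t (f.comp (AddMonoidHom.mulLeft x)) (j y * b) := rfl
  have hadd (f g : R →+ AddCircle (1 : ℚ)) (τ : R ⊗[K] R) : Γ (f + g) τ = Γ f τ + Γ g τ := by
    induction τ using TensorProduct.induction_on with
    | zero => simp
    | tmul x y =>
      ext b
      rw [AddMonoidHom.add_apply, hΓ, hΓ, hΓ, AddMonoidHom.add_comp, map_add,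
        AddMonoidHom.add_apply]
    | add τ τ' h h' => rw [map_add, map_add, map_add, h, h', add_add_add_comm]
  have hrestrict (f : R →+ AddCircle (1 : ℚ)) (r : R) (τ : R ⊗[K] R) :
      Γ f τ (j r) = f (LinearMap.mul' K R τ * r) := by
    induction τ using TensorProduct.induction_on with
    | zero => simp
    | tmul x y => rw [hΓ, ← map_mul, ht, LinearMap.mul'_apply, mul_assoc]; rfl
    | add τ τ' h h' => rw [map_add, AddMonoidHom.add_apply, h, h', map_add, add_mul, map_add]
  have hright (f : R →+ AddCircle (1 : ℚ)) (r : R) (b : S) (τ : R ⊗[K] R) :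
      Γ (f.comp (AddMonoidHom.mulRight r)) τ b = Γ f τ (b * j r) := by
    induction τ using TensorProduct.induction_on with
    | zero => simp
    | tmul x y =>
      rw [hΓ, hΓ, ← mul_assoc, ← htr]
      refine congrArg (t · (j y * b)) ?_
      ext r'
      exact congrArg f (mul_assoc _ _ _)
    | add τ τ' h h' => rw [map_add, map_add, AddMonoidHom.add_apply, AddMonoidHom.add_apply, h, h']
  have hleft (f : R →+ AddCircle (1 : ℚ)) (r : R) (b : S) (τ : R ⊗[K] R) :
      Γ (f.comp (AddMonoidHom.mulLeft r)) τ b = Γ f ((LinearMap.mulLeft K r).rTensor R τ) b := by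
    induction τ using TensorProduct.induction_on with
    | zero => simp
    | tmul x y =>
      rw [LinearMap.rTensor_tmul, LinearMap.mulLeft_apply, hΓ, hΓ]
      refine congrArg (t · (j y * b)) ?_
      ext r'
      exact congrArg f (mul_assoc _ _ _).symm
    | add τ τ' h h' =>
      rw [map_add, map_add, map_add, AddMonoidHom.add_apply, AddMonoidHom.add_apply, h, h']
  have hleft' (f : R →+ AddCircle (1 : ℚ)) (r : R) (b : S) (τ : R ⊗[K] R) :
      Γ f τ (j r * b) = Γ f ((LinearMap.mulRight K r).lTensor R τ) b := by
    induction τ using TensorProduct.induction_on with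
    | zero => simp
    | tmul x y =>
      rw [LinearMap.lTensor_tmul, LinearMap.mulRight_apply, hΓ, hΓ, map_mul j, mul_assoc]
    | add τ τ' h h' =>
      rw [map_add, map_add, map_add, AddMonoidHom.add_apply, AddMonoidHom.add_apply, h, h']
  -- Restriction uses `μ(e) = 1`, left linearity uses `r e = e r`, and right linearity is inherited
  -- from `t`.
  exact ⟨
    { toFun := AddMonoidHom.mk' (fun f => Γ f e) fun f g => hadd f g e
      restrict := fun f r => by
        refine (hrestrict f r e).trans ?_
        rw [he, one_mul]
      mul_right := fun f r b => hright f r b e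
      mul_left := fun f r b => by
        refine (hleft f r b e).trans ?_
        rw [hc]
        exact (hleft' f r b e).symm }⟩

/-- A splitting for `j` gives one for the map of opposite rings. -/
def CharacterSplitting.op (s : CharacterSplitting j) : CharacterSplitting (RingHom.op j) where
  toFun :=
    { toFun := fun f => (s.toFun (f.comp (opAddEquiv (α := R)).toAddMonoidHom)).comp
        (opAddEquiv (α := S)).symm.toAddMonoidHom
      map_zero' := by rw [AddMonoidHom.zero_comp, map_zero, AddMonoidHom.zero_comp]
      map_add' := fun f g => by rw [AddMonoidHom.add_comp, map_add, AddMonoidHom.add_comp] }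
  restrict f r := s.restrict (f.comp (opAddEquiv (α := R)).toAddMonoidHom) (unop r)
  mul_right f r b := s.mul_left (f.comp (opAddEquiv (α := R)).toAddMonoidHom) (unop r) (unop b)
  mul_left f r b := s.mul_right (f.comp (opAddEquiv (α := R)).toAddMonoidHom) (unop r) (unop b)

/-- A splitting for the map of opposite rings gives one for `j`. -/
def CharacterSplitting.unop (s : CharacterSplitting (RingHom.op j)) : CharacterSplitting j where
  toFun :=
    { toFun := fun f => (s.toFun (f.comp (opAddEquiv (α := R)).symm.toAddMonoidHom)).comp
        (opAddEquiv (α := S)).toAddMonoidHom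
      map_zero' := by rw [AddMonoidHom.zero_comp, map_zero, AddMonoidHom.zero_comp]
      map_add' := fun f g => by rw [AddMonoidHom.add_comp, map_add, AddMonoidHom.add_comp] }
  restrict f r := s.restrict (f.comp (opAddEquiv (α := R)).symm.toAddMonoidHom) (MulOpposite.op r)
  mul_right f r b := s.mul_left (f.comp (opAddEquiv (α := R)).symm.toAddMonoidHom)
    (MulOpposite.op r) (MulOpposite.op b)
  mul_left f r b := s.mul_right (f.comp (opAddEquiv (α := R)).symm.toAddMonoidHom)
    (MulOpposite.op r) (MulOpposite.op b)

theorem isSplitEpi_map_homBimodule_iff :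
    (CharacterBimodule.map (Along.homBimodule j)).IsSplitEpi ↔
      Nonempty (CharacterSplitting j) := by
  constructor
  · rintro ⟨s, hs⟩
    exact ⟨
      { toFun := s.toAddMonoidHom
        restrict := fun f r => DFunLike.congr_fun (F := CharacterBimodule R) (hs f) r
        mul_right := fun f r b =>
          DFunLike.congr_fun (F := CharacterBimodule (Along j)) (s.map_smul_left r f) b
        mul_left := fun f r b =>
          DFunLike.congr_fun (F := CharacterBimodule (Along j)) (s.map_smul_right r f) b }⟩
  · rintro ⟨s⟩
    exact ⟨
      { toFun := s.toFun
        map_zero' := map_zero s.toFun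
        map_add' := map_add s.toFun
        map_smul_left := fun r f => CharacterBimodule.ext fun b => s.mul_right f r b
        map_smul_right := fun r f => CharacterBimodule.ext fun b => s.mul_left f r b },
      fun f => CharacterBimodule.ext fun r => s.restrict f r⟩

end Splitting

/-! ### The adjunctions between extension and restriction of scalars -/

/-- The additive map `M ⊗_A N → P` given by a balanced biadditive map. -/
def BalancedTensor.lift {A M N : Type u} {P : Type*} [Ring A] [AddCommGroup M] [Module Aᵐᵒᵖ M]
    [AddCommGroup N] [Module A N] [AddCommGroup P] (β : M →+ N →+ P)
    (h : ∀ m (a : A) n, β (op a • m) n = β m (a • n)) : BalancedTensor A M N →+ P :=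
  QuotientAddGroup.lift (balancedRelations A M N)
    (TensorProduct.liftAddHom β fun r m n => by
      rw [map_zsmul, map_zsmul, AddMonoidHom.zsmul_apply])
    ((AddSubgroup.closure_le _).2 (by
      rintro _ ⟨m, a, n, rfl⟩
      refine (map_sub _ _ _).trans (sub_eq_zero.2 ?_)
      exact h m a n))

section Adjunctions

variable {A B : Type u} [Ring A] [Ring B] (i : A →+* B)

/-- The unit element of `B`. -/
def Along.one : Along i := (1 : B)

/-- The map `X → B ⊗_A X`, `x ↦ 1 ⊗ x`. -/
def extendLeftUnit (X : ModuleCat.{u} A) :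
    X ⟶ (ModuleCat.restrictScalars.{u} i).obj ((extendLeft i).obj X) :=
  ModuleCat.ofHom (Y := (ModuleCat.restrictScalars.{u} i).obj ((extendLeft i).obj X))
    { toFun := fun x => BalancedTensor.tmul A (Along.one i) x
      map_add' := BalancedTensor.tmul_add _
      map_smul' := fun a x => by
        rw [← BalancedTensor.smul_tmul]
        exact congrArg (BalancedTensor.tmul A · x) ((one_mul (i a)).trans (mul_one (i a)).symm) }

/-- The map `B ⊗_A Z → Z`, `b ⊗ z ↦ b z`. -/
def extendLeftCounit (Z : ModuleCat.{u} B) :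
    (extendLeft i).obj ((ModuleCat.restrictScalars.{u} i).obj Z) ⟶ Z :=
  let Z' := (ModuleCat.restrictScalars.{u} i).obj Z
  let φ : BalancedTensor A (Along i) Z' →+ Z :=
    BalancedTensor.lift (A := A) (M := Along i) (N := Z') (P := Z) (smulAddHom B Z)
      fun (b : B) a (z : Z) => mul_smul b (i a) z
  ModuleCat.ofHom (X := BalancedTensor A (Along i) Z')
    { toFun := φ
      map_add' := φ.map_add
      map_smul' := fun b t => DFunLike.congr_fun (BalancedTensor.hom_ext (fun (b' : B) (z : Z) =>
          mul_smul b b' z) :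
        φ.comp (DistribSMul.toAddMonoidHom (BalancedTensor A (Along i) Z') b) =
          (DistribSMul.toAddMonoidHom Z b).comp φ) t }

/-- The functor `B ⊗_A -` is left adjoint to restriction of scalars. -/
def extendLeftAdjunction : extendLeft i ⊣ ModuleCat.restrictScalars.{u} i :=
  Adjunction.mkOfUnitCounit
    { unit :=
        { app := extendLeftUnit i
          naturality := fun _ _ _ => rfl }
      counit :=
        { app := extendLeftCounit i
          naturality := fun X Y f => ModuleCat.hom_ext (LinearMap.ext fun t =>
            DFunLike.congr_fun (BalancedTensor.hom_ext (fun (b : B) z =>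
                (f.hom.map_smul b z).symm) :
              (((extendLeft i).map ((ModuleCat.restrictScalars i).map f) ≫
                extendLeftCounit i Y).hom.toAddMonoidHom) =
              (extendLeftCounit i X ≫ f).hom.toAddMonoidHom) t) }
      left_triangle := by
        ext X : 2
        refine ModuleCat.hom_ext (LinearMap.ext fun t =>
          DFunLike.congr_fun (BalancedTensor.hom_ext (fun b x => ?_) :
            ((extendLeft i).map (extendLeftUnit i X) ≫
              extendLeftCounit i ((extendLeft i).obj X)).hom.toAddMonoidHom =
            AddMonoidHom.id (BalancedTensor A (Along i) X)) t)
        exact congrArg (BalancedTensor.tmul A · x) (mul_one (M := B) b)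
      right_triangle := by
        ext Z : 2
        exact ModuleCat.hom_ext (LinearMap.ext fun (z : Z) => one_smul B z) }

theorem unitHom_extendLeftAdjunction (X : ModuleCat.{u} A) (x : X) :
    unitHom (extendLeftAdjunction i) X x = BalancedTensor.tmul A (Along.one i) x := rfl

/-- The map `X → X ⊗_A B`, `x ↦ x ⊗ 1`. -/
def extendRightUnit (X : ModuleCat.{u} Aᵐᵒᵖ) :
    X ⟶ (ModuleCat.restrictScalars.{u} (RingHom.op i)).obj ((extendRight i).obj X) :=
  ModuleCat.ofHom (Y := (ModuleCat.restrictScalars.{u} (RingHom.op i)).obj ((extendRight i).obj X))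
    { toFun := fun x => BalancedTensor.tmul A x (Along.one i)
      map_add' := fun x y => BalancedTensor.add_tmul x y _
      map_smul' := fun a x => by
        refine (BalancedTensor.smul_tmul A x (unop a) _).trans ?_
        exact congrArg (BalancedTensor.tmul A x)
          ((mul_one (i (unop a))).trans (one_mul (i (unop a))).symm) }

/-- The map `Z ⊗_A B → Z`, `z ⊗ b ↦ z b`. -/
def extendRightCounit (Z : ModuleCat.{u} Bᵐᵒᵖ) :
    (extendRight i).obj ((ModuleCat.restrictScalars.{u} (RingHom.op i)).obj Z) ⟶ Z :=
  let Z' := (ModuleCat.restrictScalars.{u} (RingHom.op i)).obj Z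
  let φ : BalancedTensor A Z' (Along i) →+ Z :=
    BalancedTensor.lift (A := A) (M := Z') (N := Along i) (P := Z)
      (AddMonoidHom.flip ((smulAddHom Bᵐᵒᵖ Z).comp (opAddEquiv (α := B)).toAddMonoidHom))
      fun (z : Z) a (b : B) => (mul_smul (op b) (op (i a)) z).symm
  ModuleCat.ofHom (X := BalancedTensor A Z' (Along i))
    { toFun := φ
      map_add' := φ.map_add
      map_smul' := fun b t => DFunLike.congr_fun (BalancedTensor.hom_ext (fun (z : Z) (b' : B) =>
          mul_smul b (op b') z) :
        φ.comp (DistribSMul.toAddMonoidHom (BalancedTensor A Z' (Along i)) b) =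
          (DistribSMul.toAddMonoidHom Z b).comp φ) t }

/-- The functor `- ⊗_A B` is left adjoint to restriction of scalars. -/
def extendRightAdjunction : extendRight i ⊣ ModuleCat.restrictScalars.{u} (RingHom.op i) :=
  Adjunction.mkOfUnitCounit
    { unit :=
        { app := extendRightUnit i
          naturality := fun _ _ _ => rfl }
      counit :=
        { app := extendRightCounit i
          naturality := fun X Y f => ModuleCat.hom_ext (LinearMap.ext fun t =>
            DFunLike.congr_fun (BalancedTensor.hom_ext (fun z (b : B) =>
                (f.hom.map_smul (op b) z).symm) :
              (((extendRight i).map ((ModuleCat.restrictScalars (RingHom.op i)).map f) ≫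
                extendRightCounit i Y).hom.toAddMonoidHom) =
              (extendRightCounit i X ≫ f).hom.toAddMonoidHom) t) }
      left_triangle := by
        ext X : 2
        refine ModuleCat.hom_ext (LinearMap.ext fun t =>
          DFunLike.congr_fun (BalancedTensor.hom_ext (fun x b => ?_) :
            ((extendRight i).map (extendRightUnit i X) ≫
              extendRightCounit i ((extendRight i).obj X)).hom.toAddMonoidHom =
            AddMonoidHom.id (BalancedTensor A X (Along i))) t)
        exact congrArg (BalancedTensor.tmul A x) (one_mul (M := B) b)
      right_triangle := by
        ext Z : 2
        exact ModuleCat.hom_ext (LinearMap.ext fun (z : Z) => one_smul Bᵐᵒᵖ z) }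

theorem unitHom_extendRightAdjunction (X : ModuleCat.{u} Aᵐᵒᵖ) (x : X) :
    unitHom (extendRightAdjunction i) X x = BalancedTensor.tmul A x (Along.one i) := rfl

/-! ### Purity in terms of the units -/

theorem BalancedTensor.exists_tmul_one_left {L : Type u} [AddCommGroup L] [Module A L]
    (t : BalancedTensor A A L) : ∃ l : L, t = BalancedTensor.tmul A (1 : A) l := by
  obtain ⟨t, rfl⟩ := QuotientAddGroup.mk_surjective t
  induction t using TensorProduct.induction_on with
  | zero => exact ⟨0, (BalancedTensor.tmul_zero (A := A) (1 : A)).symm⟩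
  | tmul a l =>
    refine ⟨a • l, .trans ?_ (BalancedTensor.smul_tmul A (1 : A) a l)⟩
    exact congrArg (BalancedTensor.tmul A · l) (one_mul a).symm
  | add x y hx hy =>
    obtain ⟨l, hl⟩ := hx
    obtain ⟨m, hm⟩ := hy
    exact ⟨l + m, by rw [BalancedTensor.tmul_add, ← hl, ← hm]; rfl⟩

theorem BalancedTensor.exists_tmul_one_right {L : Type u} [AddCommGroup L] [Module Aᵐᵒᵖ L]
    (t : BalancedTensor A L A) : ∃ l : L, t = BalancedTensor.tmul A l (1 : A) := by
  obtain ⟨t, rfl⟩ := QuotientAddGroup.mk_surjective t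
  induction t using TensorProduct.induction_on with
  | zero => exact ⟨0, (BalancedTensor.zero_tmul (A := A) (1 : A)).symm⟩
  | tmul l a =>
    refine ⟨op a • l, .trans ?_ (BalancedTensor.smul_tmul A l a (1 : A)).symm⟩
    exact congrArg (BalancedTensor.tmul A l) (mul_one a).symm
  | add x y hx hy =>
    obtain ⟨l, hl⟩ := hx
    obtain ⟨m, hm⟩ := hy
    exact ⟨l + m, by rw [BalancedTensor.add_tmul, ← hl, ← hm]; rfl⟩

/-- Under `A ⊗_A L ≅ L` the map `i ⊗ L` becomes `l ↦ 1 ⊗ l`, the unit of `B ⊗_A -`. Purity on the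
right thus concerns the extension of left modules. -/
theorem isPureRight_homRight_iff : IsPureRight (Along.homRight i) ↔
    ∀ X, Function.Injective (unitHom (extendLeftAdjunction i) X) := by
  have hmap (L : Type u) [AddCommGroup L] [Module A L] (l : L) :
      BalancedTensor.map (Along.homRight i) (LinearMap.id : L →ₗ[A] L)
        (BalancedTensor.tmul A (1 : A) l) = BalancedTensor.tmul A (Along.one i) l :=
    congrArg (BalancedTensor.tmul A · l) i.map_one
  constructor
  · intro h X
    refine (injective_iff_map_eq_zero _).2 fun x hx => ?_
    rw [unitHom_extendLeftAdjunction, ← hmap] at hx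
    have h0 := (injective_iff_map_eq_zero _).1 (h X) _ hx
    have : (1 : A) • x = 0 :=
      (congrArg (BalancedTensor.lift (A := A) (M := A) (smulAddHom A X)
        fun m a x => mul_smul m a x) h0).trans (map_zero _)
    simpa using this
  · intro h L _ _
    refine (injective_iff_map_eq_zero _).2 fun t ht => ?_
    obtain ⟨l, rfl⟩ := BalancedTensor.exists_tmul_one_left t
    rw [hmap] at ht
    rw [(injective_iff_map_eq_zero _).1 (h (ModuleCat.of A L)) l ht, BalancedTensor.tmul_zero]

theorem isPureLeft_homLeft_iff : IsPureLeft (Along.homLeft i) ↔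
    ∀ X, Function.Injective (unitHom (extendRightAdjunction i) X) := by
  have hmap (L : Type u) [AddCommGroup L] [Module Aᵐᵒᵖ L] (l : L) :
      BalancedTensor.map (LinearMap.id : L →ₗ[Aᵐᵒᵖ] L) (Along.homLeft i)
        (BalancedTensor.tmul A l (1 : A)) = BalancedTensor.tmul A l (Along.one i) :=
    congrArg (BalancedTensor.tmul A l) i.map_one
  constructor
  · intro h X
    refine (injective_iff_map_eq_zero _).2 fun x hx => ?_
    rw [unitHom_extendRightAdjunction, ← hmap] at hx
    have h0 := (injective_iff_map_eq_zero _).1 (h X) _ hx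
    have : op (1 : A) • x = 0 :=
      (congrArg (BalancedTensor.lift (A := A) (N := A)
        (AddMonoidHom.flip ((smulAddHom Aᵐᵒᵖ X).comp (opAddEquiv (α := A)).toAddMonoidHom))
        fun x a m => (mul_smul (op m) (op a) x).symm) h0).trans (map_zero _)
    simpa using this
  · intro h L _ _
    refine (injective_iff_map_eq_zero _).2 fun t ht => ?_
    obtain ⟨l, rfl⟩ := BalancedTensor.exists_tmul_one_right t
    rw [hmap] at ht
    rw [(injective_iff_map_eq_zero _).1 (h (ModuleCat.of Aᵐᵒᵖ L)) l ht, BalancedTensor.zero_tmul]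

end Adjunctions

end

end NCDescent

open NCDescent in
theorem theorem3p4 {K : Type w} {A B : Type u} [CommRing K] [Ring A] [Ring B]
    [Algebra K A] [Algebra K B] (i : A →ₐ[K] B) (hA : NCDescent.IsSeparableAlgebra K A) :
    List.TFAE
      [NCDescent.IsPureLeft (NCDescent.Along.homLeft (i : A →+* B)),
        NCDescent.IsPureRight (NCDescent.Along.homRight (i : A →+* B)),
        (NCDescent.CharacterBimodule.map
          (NCDescent.Along.homBimodule (i : A →+* B))).IsSplitEpi,
        NCDescent.IsComonadic (NCDescent.extendRight (i : A →+* B)),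
        NCDescent.IsComonadic (NCDescent.extendLeft (i : A →+* B))] := by
  have he := hA.hasSeparabilityIdempotent
  have hcentral (k : K) (b : B) :
      (i : A →+* B) (algebraMap K A k) * b = b * (i : A →+* B) (algebraMap K A k) := by
    simpa using Algebra.commutes k b
  rw [isPureLeft_homLeft_iff, isPureRight_homRight_iff, isSplitEpi_map_homBimodule_iff]
  -- The units of `- ⊗_A B` belong to `Aᵐᵒᵖ → Bᵐᵒᵖ`, so averaging takes place over the opposite
  -- rings and the splitting is carried back.
  tfae_have 1 → 3 := fun h => by
    obtain ⟨t, ht, htr⟩ := exists_linear_section _ h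
    obtain ⟨s⟩ := he.op.nonempty_characterSplitting (j := RingHom.op (i : A →+* B))
      (fun k b => congrArg op (hcentral k (unop b)).symm) t ht htr
    exact ⟨s.unop⟩
  tfae_have 2 → 3 := fun h => by
    obtain ⟨t, ht, htr⟩ := exists_linear_section _ h
    exact he.nonempty_characterSplitting hcentral t ht htr
  tfae_have 3 → 4 := fun ⟨s⟩ => CharacterSplitting.isComonadic (extendRightAdjunction _) s.op
  tfae_have 3 → 5 := fun ⟨s⟩ => CharacterSplitting.isComonadic (extendLeftAdjunction _) s
  tfae_have 4 → 1 := fun h => by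
    have := h.faithful
    exact unitHom_injective_of_faithful _
  tfae_have 5 → 2 := fun h => by
    have := h.faithful
    exact unitHom_injective_of_faithful _
  tfae_finish
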